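/- Let $\overline{\mathbb Q}$ be an algebraic closure of $\mathbb Q$, and let $\mathbb L=\overline{\mathbb Q}((T^{-1}))$ be the field of formal Laurent series $\sum_{i\le N}c_iT^i$, which contains $\overline{\mathbb Q}(T)$. For $\alpha=\sum_{i\le N}c_iT^i\in\mathbb L$ let $\lfloor\alpha\rfloor=\sum_{0\le i\le N}c_iT^i$ be its polynomial part, and let $\alpha=[a_0,a_1,\dots]$ be its regular continued fraction expansion, given by $\alpha_0=\alpha$, $a_n=\lfloor\alpha_n\rfloor$, $\alpha_{n+1}=1/(\alpha_n-a_n)$ (ending if some $\alpha_n$ is a polynomial). Call $\alpha$ normal if $\sup_{n\ge1}\deg a_n=1$. Call $\alpha,\beta\in\mathbb L$ equivalent if $\alpha=\frac{A\beta+B}{C\beta+E}$ for some $\begin{pmatrix}A&B\\C&E\end{pmatrix}\in\mathrm{GL}_2(\overline{\mathbb Q}[T])$. Let $D\in\overline{\mathbb Q}[T]$ be a polynomial of positive even degree which is not a square in $\overline{\mathbb Q}[T]$ (not necessarily squarefree; its leading coefficient is automatically a square in $\overline{\mathbb Q}$), and let $\sqrt D\in\mathbb L$ be a square root of $D$, which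 exists and is unique up to sign. Then the field $\overline{\mathbb Q}(T,\sqrt D)\subset\mathbb L$ contains infinitely many pairwise non-equivalent normal elements that do not belong to $\overline{\mathbb Q}(T)$. (This is McMullen's strong conjecture for polynomials over the field $\overline{\mathbb Q}$.) -/

import Mathlib

open scoped Polynomial

noncomputable section

namespace PolyCF

variable (K : Type*) [Field K]

/-- The field `𝕃_K = K((T⁻¹))` of formal Laurent series `∑_{i ≤ N} c_i T^i`. As a type it is Mathlib's
field of Laurent series in the uniformizer `T⁻¹`: the coefficient of `T^i` in `α` is
`α.coeff (-i)`. -/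
abbrev SeriesAtInfinity : Type _ := LaurentSeries K

variable {K}

/-- The element `T` of `K((T⁻¹))`, i.e. the inverse of the uniformizer. -/
def seriesT : SeriesAtInfinity K := HahnSeries.single (-1 : ℤ) (1 : K)

/-- The inclusion of `K[T]` in `K((T⁻¹))`, sending the variable to `T`. -/
def ofPoly : K[X] →+* SeriesAtInfinity K := Polynomial.eval₂RingHom HahnSeries.C seriesT

/-- The polynomial part `⌊α⌋ = ∑_{i ≥ 0} c_i T^i` of `α = ∑_{i ≤ N} c_i T^i`. (No nonnegative power
of `T` above `T^(-α.order)` occurs in `α`.) -/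
def polyPart (α : SeriesAtInfinity K) : K[X] :=
  ∑ i ∈ Finset.range ((-α.order).toNat + 1), Polynomial.monomial i (α.coeff (-(i : ℤ)))

/-- The complete quotients `α_0 = α`, `α_{n+1} = 1 / (α_n - ⌊α_n⌋)`. When some `α_n` is a polynomial
the expansion terminates there, and all later values are `0`. -/
def completeQuotient (α : SeriesAtInfinity K) : ℕ → SeriesAtInfinity K
  | 0 => α
  | n + 1 => (completeQuotient α n - ofPoly (polyPart (completeQuotient α n)))⁻¹

/-- The partial quotients `a_n = ⌊α_n⌋` of the regular continued fraction expansion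
`α = [a_0, a_1, …]` (equal to `0` after the expansion has terminated). -/
def partialQuotient (α : SeriesAtInfinity K) (n : ℕ) : K[X] :=
  polyPart (completeQuotient α n)

/-- `K(α) = sup_{n ≥ 1} deg a_n ∈ ℕ ∪ {∞}`. -/
def degBound (α : SeriesAtInfinity K) : ℕ∞ :=
  ⨆ n : ℕ, ((partialQuotient α (n + 1)).natDegree : ℕ∞)

/-- `α` is normal if `K(α) = 1`. -/
def IsNormal (α : SeriesAtInfinity K) : Prop := degBound α = 1

/-- `α ∼ β`: `α = Mβ = (Aβ + B)/(Cβ + D)` for some `M = (A, B; C, D) ∈ GL₂(K[T])`. -/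
def Equivalent (α β : SeriesAtInfinity K) : Prop :=
  ∃ M : Matrix.GeneralLinearGroup (Fin 2) K[X],
    ofPoly (M.1 1 0) * β + ofPoly (M.1 1 1) ≠ 0 ∧
    α = (ofPoly (M.1 0 0) * β + ofPoly (M.1 0 1)) / (ofPoly (M.1 1 0) * β + ofPoly (M.1 1 1))

variable (K) in
/-- `𝒮_K`: the polynomials of positive even degree which are not squares in `K[T]` and whose leading
coefficient is a square in `K`. -/
def admissible : Set K[X] :=
  {D | 0 < D.natDegree ∧ Even D.natDegree ∧ ¬ IsSquare D ∧ IsSquare D.leadingCoeff}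

variable (K) in
/-- The field `K(T)` of rational functions, as a subfield of `K((T⁻¹))`. -/
def ratField : Subfield (SeriesAtInfinity K) :=
  Subfield.closure (Set.range (ofPoly (K := K)))

/-- The field `K(T, √D)`, as a subfield of `K((T⁻¹))`: it is generated by `K[T]` and the square roots
of `D` in `K((T⁻¹))`. For `D ∈ 𝒮_K` and `char K ≠ 2` these are exactly two opposite elements `±√D`,
so that it does not matter which of them is called `√D`. -/
def sqrtField (D : K[X]) : Subfield (SeriesAtInfinity K) :=
  Subfield.closure (Set.range (ofPoly (K := K)) ∪ {s | s ^ 2 = ofPoly D})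

end PolyCF

end

/-! Measure how well `α` is approximated by fractions `p/q` through the order of `qα - p`.
`BadlyApprox 1` forces every partial quotient of an irrational `α` after the first to have degree 1.
Liouville's inequality gives `√D` the bound `deg D`, and the coefficients of `√D` lie in a number
field `F`. The key is `BadlyApprox.sub_div_X`: replacing `α` by `(α - c)/T` with `c ∉ F` lowers the
bound by one, as long as it stays at least 1. A very good approximation `P/q` of `α` is defined over
`F`, so `P(0)/q(0)` cannot equal `c`. As the algebraic closure of `ℚ` has infinite degree, a new `c`
exists at every step; from step `deg D` on, all the elements `(√D - P)/Tⁿ` are normal. They are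
inequivalent because the quadratic form of `(√D - P)/Tⁿ` has discriminant `4DT²ⁿ` and is primitive
at `T` when `P(0)² ≠ D(0)`; hence equivalence determines `n`. -/

namespace PolyCF

variable {K : Type*} [Field K]

/-! ### Polynomials inside the Laurent series field -/

section OfPoly

theorem ofPoly_C (c : K) : ofPoly (Polynomial.C c) = HahnSeries.single (0 : ℤ) c := by
  simp [ofPoly, HahnSeries.C_apply]

theorem ofPoly_X : ofPoly (Polynomial.X : K[X]) = HahnSeries.single (-1 : ℤ) 1 := by
  simp [ofPoly, seriesT]

theorem ofPoly_monomial (i : ℕ) (c : K) :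
    ofPoly (Polynomial.monomial i c) = HahnSeries.single (-(i : ℤ)) c := by
  simp [ofPoly, seriesT, Polynomial.eval₂_monomial, HahnSeries.C_apply, HahnSeries.single_pow]

theorem ofPoly_eq_sum {p : K[X]} {N : ℕ} (hN : p.natDegree < N) :
    ofPoly p = ∑ i ∈ Finset.range N, HahnSeries.single (-(i : ℤ)) (p.coeff i) := by
  conv_lhs => rw [p.as_sum_range' N hN, map_sum]
  simp_rw [ofPoly_monomial]

theorem coeff_ofPoly_mul {p : K[X]} {N : ℕ} (hN : p.natDegree < N) (α : SeriesAtInfinity K)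
    (n : ℤ) : (ofPoly p * α).coeff n = ∑ i ∈ Finset.range N, p.coeff i * α.coeff (n + i) := by
  rw [ofPoly_eq_sum hN, Finset.sum_mul, HahnSeries.coeff_sum]
  simp [HahnSeries.coeff_single_mul]

theorem coeff_ofPoly_neg (p : K[X]) (i : ℕ) : (ofPoly p).coeff (-(i : ℤ)) = p.coeff i := by
  rw [ofPoly_eq_sum (N := p.natDegree + i + 1) (by omega), HahnSeries.coeff_sum,
    Finset.sum_eq_single i]
  · simp
  · intro j _ hj
    exact HahnSeries.coeff_single_of_ne (by omega)
  · intro h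
    exact absurd (Finset.mem_range.2 (by omega)) h

theorem coeff_ofPoly_of_pos (p : K[X]) {n : ℤ} (hn : 0 < n) : (ofPoly p).coeff n = 0 := by
  rw [ofPoly_eq_sum (Nat.lt_succ_self _), HahnSeries.coeff_sum]
  exact Finset.sum_eq_zero fun j _ => HahnSeries.coeff_single_of_ne (by omega)

theorem ofPoly_injective : Function.Injective (ofPoly (K := K)) := by
  intro p q h
  ext i
  rw [← coeff_ofPoly_neg, h, coeff_ofPoly_neg]

theorem ofPoly_ne_zero {p : K[X]} (hp : p ≠ 0) : ofPoly p ≠ 0 :=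
  fun h => hp (ofPoly_injective (h.trans (map_zero _).symm))

theorem coeff_order_ne_zero {α : SeriesAtInfinity K} (hα : α ≠ 0) : α.coeff α.order ≠ 0 := by
  simpa [HahnSeries.coeff_order_eq_zero] using hα

theorem le_order {α : SeriesAtInfinity K} (hα : α ≠ 0) {n : ℤ} (h : ∀ m < n, α.coeff m = 0) :
    n ≤ α.order :=
  not_lt.1 fun hlt => coeff_order_ne_zero hα (h _ hlt)

theorem order_ofPoly {p : K[X]} (hp : p ≠ 0) : (ofPoly p).order = -(p.natDegree : ℤ) := by
  apply le_antisymm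
  · apply HahnSeries.order_le_of_coeff_ne_zero
    rw [coeff_ofPoly_neg]
    simpa using hp
  · refine le_order (ofPoly_ne_zero hp) fun m hm => ?_
    obtain ⟨i, rfl⟩ : ∃ i : ℕ, m = -(i : ℤ) := ⟨m.natAbs, by omega⟩
    rw [coeff_ofPoly_neg]
    exact Polynomial.coeff_eq_zero_of_natDegree_lt (by omega)

theorem order_sub_ge {α β : SeriesAtInfinity K} (h : α - β ≠ 0) :
    min α.order β.order ≤ (α - β).order := by
  rw [sub_eq_add_neg] at h ⊢
  simpa using HahnSeries.min_order_le_order_add h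

theorem eq_zero_of_order_pos {p : K[X]} (h : ∀ n ≤ 0, (ofPoly p).coeff n = 0) : p = 0 := by
  ext i
  rw [← coeff_ofPoly_neg, h _ (by omega), Polynomial.coeff_zero]

theorem order_inv' {α : SeriesAtInfinity K} (hα : α ≠ 0) : (α⁻¹).order = -α.order := by
  have h := HahnSeries.order_mul hα (inv_ne_zero hα)
  rw [mul_inv_cancel₀ hα, HahnSeries.order_one] at h
  omega

end OfPoly

/-! ### Irrational series -/

section Irrational

/-- The elements of `K((T⁻¹))` that are not quotients of two polynomials. -/
def Irr (α : SeriesAtInfinity K) : Prop :=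
  ∀ p q : K[X], q ≠ 0 → ofPoly q * α - ofPoly p ≠ 0

theorem mem_ratField_iff {α : SeriesAtInfinity K} :
    α ∈ ratField K ↔ ∃ p q : K[X], q ≠ 0 ∧ ofPoly q * α = ofPoly p := by
  have hcl : Subring.closure (Set.range (ofPoly (K := K))) = (ofPoly (K := K)).range := by
    rw [← RingHom.coe_range, Subring.closure_eq]
  rw [ratField, Subfield.mem_closure_iff, hcl]
  constructor
  · rintro ⟨_, ⟨p, rfl⟩, _, ⟨q, rfl⟩, rfl⟩
    by_cases hq : q = 0
    · exact ⟨0, 1, one_ne_zero, by simp [hq]⟩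
    · exact ⟨p, q, hq, mul_div_cancel₀ _ (ofPoly_ne_zero hq)⟩
  · rintro ⟨p, q, hq, h⟩
    exact ⟨_, ⟨p, rfl⟩, _, ⟨q, rfl⟩, by rw [← h, mul_div_cancel_left₀ _ (ofPoly_ne_zero hq)]⟩

theorem Irr.notMem_ratField {α : SeriesAtInfinity K} (h : Irr α) : α ∉ ratField K := by
  rw [mem_ratField_iff]
  rintro ⟨p, q, hq, hpq⟩
  exact h p q hq (sub_eq_zero.2 hpq)

/-- A square root of a non-square polynomial is irrational. -/
theorem irr_of_sq_eq {D : K[X]} (hD : ¬ IsSquare D) {s : SeriesAtInfinity K}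
    (hs : s ^ 2 = ofPoly D) : Irr s := by
  intro p q hq h
  have h1 : q ^ 2 * D = p ^ 2 := by
    apply ofPoly_injective
    simp only [map_mul, map_pow, ← hs]
    rw [← sub_eq_zero.1 h]
    ring
  obtain ⟨r, rfl⟩ : q ∣ p := (IsIntegrallyClosed.pow_dvd_pow_iff two_ne_zero).1 (Dvd.intro _ h1)
  refine hD ⟨r, mul_left_cancel₀ (pow_ne_zero 2 hq) ?_⟩
  rw [h1]; ring

theorem Irr.add_mul_eq_zero {β : SeriesAtInfinity K} (hβ : Irr β) {q p : K[X]}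
    (h : ofPoly q * β + ofPoly p = 0) : q = 0 ∧ p = 0 := by
  have hq : q = 0 := by
    by_contra hq
    exact hβ (-p) q hq (by simpa using h)
  subst hq
  exact ⟨rfl, ofPoly_injective (by simpa using h)⟩

theorem Irr.sub_div_pow {s : SeriesAtInfinity K} (hs : Irr s) (P : K[X]) (n : ℕ) :
    Irr ((s - ofPoly P) / ofPoly (Polynomial.X ^ n)) := by
  intro p q hq h
  have hX : ofPoly (Polynomial.X ^ n : K[X]) ≠ 0 := ofPoly_ne_zero (pow_ne_zero _ Polynomial.X_ne_zero)
  refine hs (q * P + p * Polynomial.X ^ n) q hq ?_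
  field_simp at h
  rw [map_add, map_mul, map_mul]
  linear_combination h

end Irrational

/-! ### Diophantine approximation -/

section Approximation

/-- `α` is approximable to degree at most `b`: one has `deg (q α - p) ≥ -deg q - b` for all
polynomials `p` and `q ≠ 0`. -/
def BadlyApprox (b : ℕ) (α : SeriesAtInfinity K) : Prop :=
  ∀ p q : K[X], q ≠ 0 → (ofPoly q * α - ofPoly p).order ≤ (q.natDegree : ℤ) + b

theorem BadlyApprox.mono {b c : ℕ} (hbc : b ≤ c) {α : SeriesAtInfinity K} (h : BadlyApprox b α) :
    BadlyApprox c α := fun p q hq => (h p q hq).trans (by omega)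

/-- Liouville's inequality for square roots of polynomials. -/
theorem badlyApprox_of_sq_eq [CharZero K] {D : K[X]} (hD : ¬ IsSquare D) {s : SeriesAtInfinity K}
    (hs : s ^ 2 = ofPoly D) : BadlyApprox D.natDegree s := by
  intro p q hq
  have hirr := irr_of_sq_eq hD hs
  set θ := ofPoly q * s - ofPoly p with hθ
  have hθ0 : θ ≠ 0 := hirr p q hq
  have hθ1 : ofPoly q * s - ofPoly (-p) ≠ 0 := hirr (-p) q hq
  by_contra! hlt
  have hD0 : D ≠ 0 := fun h => hD (h ▸ IsSquare.zero)
  have hs0 : s ≠ 0 := by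
    rintro rfl
    exact ofPoly_ne_zero hD0 (by rw [← hs]; simp)
  have hos : 2 * s.order = -(D.natDegree : ℤ) := by
    rw [← order_ofPoly hD0, ← hs, pow_two, HahnSeries.order_mul hs0 hs0, two_mul]
  -- The norm of `θ` is a nonzero polynomial, so its order is at most 0; a large order of `θ` would
  -- force a very negative order of the conjugate `2qs - θ`, which is impossible.
  have hprod : θ * (ofPoly q * s - ofPoly (-p)) = ofPoly (q ^ 2 * D - p ^ 2) := by
    simp only [map_sub, map_mul, map_pow, map_neg, ← hs, hθ]; ring
  have hne : q ^ 2 * D - p ^ 2 ≠ 0 := by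
    intro h0
    rw [h0, map_zero] at hprod
    exact mul_ne_zero hθ0 hθ1 hprod
  have ho := congrArg HahnSeries.order hprod
  rw [order_ofPoly hne, HahnSeries.order_mul hθ0 hθ1] at ho
  have hconj : ofPoly q * s - ofPoly (-p) = ofPoly (2 * q) * s - θ := by
    simp only [map_neg, map_mul, map_ofNat, hθ]; ring
  have h2q : (2 : K[X]) * q ≠ 0 := mul_ne_zero two_ne_zero hq
  have hdeg : ((2 : K[X]) * q).natDegree = q.natDegree := by
    have : (2 : K[X]) = Polynomial.C 2 := (Polynomial.C_ofNat 2).symm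
    rw [this, Polynomial.natDegree_C_mul two_ne_zero]
  have hge := order_sub_ge (hconj ▸ hθ1)
  rw [← hconj, HahnSeries.order_mul (ofPoly_ne_zero h2q) hs0, order_ofPoly h2q, hdeg] at hge
  rcases min_le_iff.1 hge with h | h <;> omega

/-- A polynomial with the coefficients of a given one transformed by an additive map. -/
theorem exists_poly_coeff_map (φ : K → K) (h0 : φ 0 = 0) (q : K[X]) :
    ∃ q' : K[X], q'.natDegree ≤ q.natDegree ∧ ∀ i, q'.coeff i = φ (q.coeff i) := by
  refine ⟨∑ i ∈ Finset.range (q.natDegree + 1), Polynomial.monomial i (φ (q.coeff i)),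
    Polynomial.natDegree_sum_le_of_forall_le _ _ fun i hi => ?_, fun i => ?_⟩
  · exact (Polynomial.natDegree_monomial_le _).trans (by simpa [Nat.lt_succ_iff] using hi)
  · rw [Polynomial.finsetSum_coeff]
    simp only [Polynomial.coeff_monomial, Finset.sum_ite_eq', Finset.mem_range]
    split_ifs with h
    · rfl
    · rw [Polynomial.coeff_eq_zero_of_natDegree_lt (by omega), h0]

/-- An `F`-linear map commutes with multiplication by the coefficients of `α`. -/
theorem coeff_ofPoly_mul_map {F : Subfield K} {α : SeriesAtInfinity K}
    (hα : ∀ n, α.coeff n ∈ F) (φ : K →ₗ[F] K) {q q' : K[X]} (hd : q'.natDegree ≤ q.natDegree)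
    (hq : ∀ i, q'.coeff i = φ (q.coeff i)) (n : ℤ) :
    (ofPoly q' * α).coeff n = φ ((ofPoly q * α).coeff n) := by
  rw [coeff_ofPoly_mul (Nat.lt_succ_of_le hd), coeff_ofPoly_mul (Nat.lt_succ_self _), map_sum]
  refine Finset.sum_congr rfl fun i _ => ?_
  have := φ.map_smul (⟨_, hα (n + i)⟩ : F) (q.coeff i)
  rw [Subfield.smul_def, Subfield.smul_def, smul_eq_mul, smul_eq_mul] at this
  rw [mul_comm (q.coeff i), hq, mul_comm (φ _)]
  exact this.symm

/-- Good rational approximations of a series with coefficients in `F` are defined over `F`. -/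
theorem map_approx_mul_eq {F : Subfield K} {α : SeriesAtInfinity K} (hα : ∀ n, α.coeff n ∈ F)
    (φ : K →ₗ[F] K) {p q p' q' : K[X]} (happ : ∀ n ≤ (q.natDegree : ℤ),
      (ofPoly q * α - ofPoly p).coeff n = 0)
    (hd : q'.natDegree ≤ q.natDegree) (hq : ∀ i, q'.coeff i = φ (q.coeff i))
    (hp : ∀ i, p'.coeff i = φ (p.coeff i)) :
    q' * p = q * p' := by
  have h1 : ∀ n ≤ (q.natDegree : ℤ), (ofPoly q' * α - ofPoly p').coeff n = 0 := by
    intro n hn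
    have e : (ofPoly p').coeff n = φ ((ofPoly p).coeff n) := by
      rcases le_or_gt n 0 with h | h
      · obtain ⟨i, rfl⟩ : ∃ i : ℕ, n = -(i : ℤ) := ⟨n.natAbs, by omega⟩
        rw [coeff_ofPoly_neg, coeff_ofPoly_neg, hp]
      · rw [coeff_ofPoly_of_pos _ h, coeff_ofPoly_of_pos _ h, map_zero]
    rw [HahnSeries.coeff_sub, coeff_ofPoly_mul_map hα φ hd hq, e, ← map_sub,
      ← HahnSeries.coeff_sub, happ n hn, map_zero]
  rw [← sub_eq_zero]
  apply eq_zero_of_order_pos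
  intro n hn
  -- Eliminate `α`: both errors vanish up to index `deg q`, and multiplying by `q` or `q'` lowers
  -- indices by at most `deg q`.
  have e : ofPoly (q' * p - q * p') =
      ofPoly q * (ofPoly q' * α - ofPoly p') - ofPoly q' * (ofPoly q * α - ofPoly p) := by
    simp only [map_sub, map_mul]; ring
  rw [e, HahnSeries.coeff_sub, coeff_ofPoly_mul (Nat.lt_succ_self _),
    coeff_ofPoly_mul (Nat.lt_succ_of_le hd), Finset.sum_eq_zero, Finset.sum_eq_zero, sub_zero]
  · intro i hi
    rw [happ _ (by have := Finset.mem_range.1 hi; omega), mul_zero]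
  · intro i hi
    rw [h1 _ (by have := Finset.mem_range.1 hi; omega), mul_zero]

/-- Passing from `α` to `(α - c) / T`, with `c` outside the field of coefficients of `α`, lowers
the degree of approximability. -/
theorem BadlyApprox.sub_div_X {F : Subfield K} {α : SeriesAtInfinity K}
    (hα : ∀ n, α.coeff n ∈ F) (hirr : Irr α) {c : K} (hc : c ∉ F) {b : ℕ} (hb : 1 ≤ b)
    (h : BadlyApprox (b + 1) α) :
    BadlyApprox b ((α - ofPoly (Polynomial.C c)) / ofPoly Polynomial.X) := by
  intro p q hq
  have hX : ofPoly (Polynomial.X : K[X]) ≠ 0 := ofPoly_ne_zero Polynomial.X_ne_zero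
  have hXo : (ofPoly (Polynomial.X : K[X])).order = -1 := by
    rw [order_ofPoly Polynomial.X_ne_zero, Polynomial.natDegree_X]; rfl
  by_contra! hlt
  by_cases hq0 : q.coeff 0 = 0
  -- If `q = Xr`, the error is also that of denominator `r` for `α`; the drop in degree pays for the
  -- lost unit of the bound.
  · obtain ⟨r, rfl⟩ := Polynomial.X_dvd_iff.2 hq0
    have hr : r ≠ 0 := right_ne_zero_of_mul hq
    have e : ofPoly (Polynomial.X * r) * ((α - ofPoly (Polynomial.C c)) / ofPoly Polynomial.X)
        - ofPoly p = ofPoly r * α - ofPoly (p + Polynomial.C c * r) := by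
      simp only [map_mul, map_add]; field_simp; ring
    have := h (p + Polynomial.C c * r) r hr
    rw [← e] at this
    rw [Polynomial.natDegree_X_mul hr] at hlt
    push_cast at hlt this
    omega
  · set P := Polynomial.X * p + Polynomial.C c * q with hP
    set θ := ofPoly q * ((α - ofPoly (Polynomial.C c)) / ofPoly Polynomial.X) - ofPoly p with hθ
    have e : ofPoly q * α - ofPoly P = ofPoly Polynomial.X * θ := by
      simp only [hP, hθ, map_mul, map_add]; field_simp; ring
    have hθ0 : θ ≠ 0 := by
      intro h0
      rw [h0, mul_zero] at e
      exact hirr _ _ hq e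
    have happ : ∀ n ≤ (q.natDegree : ℤ), (ofPoly q * α - ofPoly P).coeff n = 0 := by
      intro n hn
      apply HahnSeries.coeff_eq_zero_of_lt_order
      rw [e, HahnSeries.order_mul hX hθ0, hXo]
      omega
    -- Choose an `F`-linear functional killing `c` but not 1. Rescaled by `q(0)⁻¹`, it kills `P(0) =
    -- c q(0)` but not `q(0)`, contradicting the proportionality of `(q', P')` and `(q, P)` at 0.
    have hnot : (1 : K) ∉ Submodule.span F {c} := by
      rw [Submodule.mem_span_singleton]
      rintro ⟨a, ha⟩
      rw [Subfield.smul_def, smul_eq_mul] at ha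
      apply hc
      rw [eq_inv_of_mul_eq_one_right ha]
      exact F.inv_mem a.2
    obtain ⟨f, hf1, hf⟩ := Submodule.exists_le_ker_of_notMem hnot
    have hfc : f c = 0 := hf (Submodule.mem_span_singleton_self c)
    let φ : K →ₗ[F] K :=
      (Algebra.linearMap F K).comp (f.comp (LinearMap.mulLeft F (q.coeff 0)⁻¹))
    have hφ : ∀ x, φ x = (f ((q.coeff 0)⁻¹ * x) : F) := fun x => rfl
    obtain ⟨q', hq'd, hq'⟩ := exists_poly_coeff_map φ (map_zero _) q
    obtain ⟨P', -, hP'⟩ := exists_poly_coeff_map φ (map_zero _) P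
    have hmul := congrArg (fun r => Polynomial.coeff r 0)
      (map_approx_mul_eq hα φ happ hq'd hq' hP')
    have hP0 : P.coeff 0 = c * q.coeff 0 := by simp [hP]
    simp only [Polynomial.mul_coeff_zero, hq', hP', hφ, hP0] at hmul
    rw [inv_mul_cancel₀ hq0, mul_comm c, inv_mul_cancel_left₀ hq0, hfc] at hmul
    have hc0 : c ≠ 0 := fun h => hc (h ▸ F.zero_mem)
    have : ((f 1 : F) : K) ≠ 0 := by simpa using hf1
    simp [hc0, hq0, this] at hmul

end Approximation

/-! ### Continued fractions and convergents -/

section ContinuedFraction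

theorem coeff_polyPart (α : SeriesAtInfinity K) (i : ℕ) :
    (polyPart α).coeff i = α.coeff (-(i : ℤ)) := by
  rw [polyPart, Polynomial.finsetSum_coeff]
  simp only [Polynomial.coeff_monomial, Finset.sum_ite_eq', Finset.mem_range]
  split_ifs with h
  · rfl
  · exact (HahnSeries.coeff_eq_zero_of_lt_order (by omega)).symm

theorem order_sub_polyPart {α : SeriesAtInfinity K} (h : α - ofPoly (polyPart α) ≠ 0) :
    1 ≤ (α - ofPoly (polyPart α)).order := by
  refine le_order h fun m hm => ?_
  obtain ⟨i, rfl⟩ : ∃ i : ℕ, m = -(i : ℤ) := ⟨m.natAbs, by omega⟩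
  rw [HahnSeries.coeff_sub, coeff_ofPoly_neg, coeff_polyPart, sub_self]

theorem natDegree_polyPart {α : SeriesAtInfinity K} (hα : α ≠ 0) (h : α.order ≤ 0) :
    ((polyPart α).natDegree : ℤ) = -α.order := by
  obtain ⟨i, hi⟩ : ∃ i : ℕ, α.order = -(i : ℤ) := ⟨α.order.natAbs, by omega⟩
  have hle : (polyPart α).natDegree ≤ i := by
    refine Polynomial.natDegree_le_iff_coeff_eq_zero.2 fun j hj => ?_
    rw [coeff_polyPart]
    exact HahnSeries.coeff_eq_zero_of_lt_order (by omega)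
  have hge : i ≤ (polyPart α).natDegree := by
    apply Polynomial.le_natDegree_of_ne_zero
    rw [coeff_polyPart, ← hi]
    exact coeff_order_ne_zero hα
  omega

/-- The complete quotients of an irrational series, in terms of two consecutive convergents. -/
theorem exists_convergents {α : SeriesAtInfinity K} (hα : Irr α) (n : ℕ) :
    ∃ p q p' q' : K[X], q ≠ 0 ∧ q'.natDegree ≤ q.natDegree ∧
      completeQuotient α (n + 1) * (ofPoly q * α - ofPoly p) = -(ofPoly q' * α - ofPoly p') ∧
      ofPoly q' * α - ofPoly p' ≠ 0 ∧
      (ofPoly q' * α - ofPoly p').order = q.natDegree ∧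
      (completeQuotient α (n + 1)).order ≤ -1 := by
  induction n with
  | zero =>
    have h0 : α - ofPoly (polyPart α) ≠ 0 := by simpa using hα (polyPart α) 1 one_ne_zero
    have h1 := order_sub_polyPart h0
    -- The starting convergents are `a₀/1` and the formal `1/0`.
    refine ⟨polyPart α, 1, 1, 0, one_ne_zero, by simp, ?_, by simp, by simp, ?_⟩
    · simp [completeQuotient, inv_mul_cancel₀ h0]
    · simp only [completeQuotient, order_inv' h0]
      omega
  | succ n ih =>
    obtain ⟨p, q, p', q', hq, hdeg, hmul, hθ', hord, hγ⟩ := ih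
    set γ := completeQuotient α (n + 1) with hγdef
    set a := polyPart γ with ha
    have hθ := hα p q hq
    have hγ0 : γ ≠ 0 := by
      intro h
      rw [h, HahnSeries.order_zero] at hγ
      omega
    have hda : (a.natDegree : ℤ) = -γ.order := natDegree_polyPart hγ0 (by omega)
    have ha0 : a ≠ 0 := by
      intro h
      rw [h, Polynomial.natDegree_zero] at hda
      omega
    have hdaq : (a * q).natDegree = a.natDegree + q.natDegree := Polynomial.natDegree_mul ha0 hq
    have hdnew : (a * q + q').natDegree = a.natDegree + q.natDegree := by
      rw [Polynomial.natDegree_add_eq_left_of_natDegree_lt (by omega), hdaq]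
    have hqnew : a * q + q' ≠ 0 := by
      intro h
      rw [h, Polynomial.natDegree_zero] at hdnew
      omega
    have hnew := hα (a * p + p') (a * q + q') hqnew
    have hrel : (γ - ofPoly a) * (ofPoly q * α - ofPoly p) =
        -(ofPoly (a * q + q') * α - ofPoly (a * p + p')) := by
      simp only [map_add, map_mul]
      linear_combination hmul
    have hsub : γ - ofPoly a ≠ 0 := by
      intro h
      rw [h, zero_mul, eq_comm, neg_eq_zero] at hrel
      exact hnew hrel
    have hoθ := congrArg HahnSeries.order hmul
    rw [HahnSeries.order_mul hγ0 hθ, HahnSeries.order_neg, hord] at hoθ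
    have hsucc : completeQuotient α (n + 1 + 1) = (γ - ofPoly a)⁻¹ := rfl
    refine ⟨a * p + p', a * q + q', p, q, hqnew, by omega, ?_, hθ, by omega, ?_⟩
    · rw [hsucc, inv_mul_eq_iff_eq_mul₀ hsub]
      linear_combination hrel
    · have : 1 ≤ (γ - ofPoly a).order := order_sub_polyPart hsub
      rw [hsucc, order_inv' hsub]
      omega

/-- Comparing orders in the convergent relation, the degree of the partial quotient is the order of
`qα - p` minus `deg q`. -/
theorem natDegree_partialQuotient {α : SeriesAtInfinity K} (hα : Irr α) (h : BadlyApprox 1 α)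
    (n : ℕ) : (partialQuotient α (n + 1)).natDegree = 1 := by
  obtain ⟨p, q, p', q', hq, -, hmul, -, hord, hγ⟩ := exists_convergents hα n
  have hγ0 : completeQuotient α (n + 1) ≠ 0 := by
    intro h
    rw [h, HahnSeries.order_zero] at hγ
    omega
  have hdeg := natDegree_polyPart hγ0 (by omega)
  have hoθ := congrArg HahnSeries.order hmul
  rw [HahnSeries.order_mul hγ0 (hα p q hq), HahnSeries.order_neg, hord] at hoθ
  have := h p q hq
  rw [partialQuotient]
  omega

theorem BadlyApprox.isNormal {α : SeriesAtInfinity K} (h : BadlyApprox 1 α) (hα : Irr α) :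
    IsNormal α := by
  simp [IsNormal, degBound, natDegree_partialQuotient hα h]

end ContinuedFraction

/-! ### Equivalence and discriminants -/

section Equivalence

theorem Equivalent.refl (α : SeriesAtInfinity K) : Equivalent α α :=
  ⟨1, by simp, by simp⟩

theorem Equivalent.exists_entries {α β : SeriesAtInfinity K} (h : Equivalent α β) :
    ∃ A B C E : K[X], IsUnit (A * E - B * C) ∧
      (ofPoly C * β + ofPoly E) * α = ofPoly A * β + ofPoly B := by
  obtain ⟨M, hM, rfl⟩ := h
  refine ⟨M.1 0 0, M.1 0 1, M.1 1 0, M.1 1 1, ?_, mul_div_cancel₀ _ hM⟩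
  rw [← Matrix.det_fin_two]
  exact (Matrix.isUnit_iff_isUnit_det _).1 M.isUnit

/-- Comparison of discriminants of equivalent elements `(√D - P) / T^n` and `(√D - Q) / T^m`. -/
theorem le_of_mobius_eq [CharZero K] {D : K[X]} (hD : D ≠ 0) {s : SeriesAtInfinity K}
    (hs : s ^ 2 = ofPoly D) (hirr : Irr s) {P Q : K[X]} {n m : ℕ}
    (hQ : Q.coeff 0 ^ 2 ≠ D.coeff 0) {A B C E : K[X]} (hdet : IsUnit (A * E - B * C))
    (h : (ofPoly C * ((s - ofPoly Q) / ofPoly (Polynomial.X ^ m)) + ofPoly E) *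
        ((s - ofPoly P) / ofPoly (Polynomial.X ^ n)) =
      ofPoly A * ((s - ofPoly Q) / ofPoly (Polynomial.X ^ m)) + ofPoly B) : m ≤ n := by
  set X : K[X] := Polynomial.X with hX
  have hX0 : ∀ k, ofPoly (X ^ k) ≠ 0 := fun k => ofPoly_ne_zero (pow_ne_zero _ Polynomial.X_ne_zero)
  have hβirr : Irr ((s - ofPoly Q) / ofPoly (X ^ m)) := hirr.sub_div_pow Q m
  set β := (s - ofPoly Q) / ofPoly (X ^ m) with hβ
  set α := (s - ofPoly P) / ofPoly (X ^ n) with hα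
  have hβs : ofPoly (X ^ m) * β + ofPoly Q = s := by rw [hβ, mul_div_cancel₀ _ (hX0 m), sub_add_cancel]
  have hαs : ofPoly (X ^ n) * α + ofPoly P = s := by rw [hα, mul_div_cancel₀ _ (hX0 n), sub_add_cancel]
  -- `a, b, c` come from substituting the Möbius map into the quadratic equation of `α` and clearing
  -- denominators.
  set a := X ^ n * X ^ n * A ^ 2 + 2 * P * X ^ n * A * C + (P ^ 2 - D) * C ^ 2 with ha
  set b := 2 * (X ^ n * X ^ n) * A * B + 2 * P * X ^ n * (A * E + B * C) +
    2 * (P ^ 2 - D) * C * E with hb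
  set c := X ^ n * X ^ n * B ^ 2 + 2 * P * X ^ n * B * E + (P ^ 2 - D) * E ^ 2 with hc
  have h1 : ofPoly a * β ^ 2 + ofPoly b * β + ofPoly c = 0 := by
    have e : (ofPoly (X ^ n) * α + ofPoly P) ^ 2 = ofPoly D := by rw [hαs, hs]
    have e' : ofPoly (X ^ n) ^ 2 * (ofPoly A * β + ofPoly B) ^ 2 +
        2 * ofPoly P * ofPoly (X ^ n) * (ofPoly A * β + ofPoly B) * (ofPoly C * β + ofPoly E) +
        (ofPoly P ^ 2 - ofPoly D) * (ofPoly C * β + ofPoly E) ^ 2 = 0 := by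
      rw [← h]
      linear_combination (ofPoly C * β + ofPoly E) ^ 2 * e
    rw [← e']
    simp only [ha, hb, hc, map_add, map_mul, map_sub, map_pow, map_ofNat]
    ring
  have h2 : ofPoly (X ^ m * X ^ m) * β ^ 2 + ofPoly (2 * Q * X ^ m) * β + ofPoly (Q ^ 2 - D) = 0 := by
    have e : (ofPoly (X ^ m) * β + ofPoly Q) ^ 2 = ofPoly D := by rw [hβs, hs]
    simp only [map_mul, map_sub, map_pow, map_ofNat] at e ⊢
    linear_combination e
  -- Eliminating `β²` leaves a linear relation, so irrationality makes the two forms proportional.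
  have h3 : ofPoly (X ^ m * X ^ m * b - a * (2 * Q * X ^ m)) * β +
      ofPoly (X ^ m * X ^ m * c - a * (Q ^ 2 - D)) = 0 := by
    rw [map_sub, map_sub, map_mul _ (X ^ m * X ^ m), map_mul _ a, map_mul _ (X ^ m * X ^ m) c,
      map_mul _ a]
    linear_combination ofPoly (X ^ m * X ^ m) * h1 - ofPoly a * h2
  obtain ⟨hb1, hc1⟩ := hβirr.add_mul_eq_zero h3
  have hndvd : ¬ X ∣ Q ^ 2 - D := by
    rw [hX, Polynomial.X_dvd_iff]
    simpa [pow_two, sub_eq_zero] using hQ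
  -- Primitivity at `X` makes the ratio `g` of the forms a polynomial; discriminants then give
  -- `g²X²ᵐ = det² X²ⁿ`.
  have hXm : X ^ (m + m) ≠ 0 := pow_ne_zero _ Polynomial.X_ne_zero
  obtain ⟨g, hg⟩ : X ^ (m + m) ∣ a := by
    refine Polynomial.prime_X.pow_dvd_of_dvd_mul_right _ hndvd ⟨c, ?_⟩
    rw [← hX, pow_add]
    linear_combination -hc1
  rw [pow_add] at hXm hg
  have hcg : c = g * (Q ^ 2 - D) := by
    apply mul_left_cancel₀ hXm
    rw [hg] at hc1
    linear_combination hc1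
  have hbg : b = g * (2 * Q * X ^ m) := by
    apply mul_left_cancel₀ hXm
    rw [hg] at hb1
    linear_combination hb1
  have hdisc : b ^ 2 - 4 * a * c = (A * E - B * C) ^ 2 * (4 * D * (X ^ n * X ^ n)) := by
    rw [ha, hb, hc]; ring
  have h4D : (4 : K[X]) * D ≠ 0 := mul_ne_zero (by norm_num) hD
  have hfin : g ^ 2 * (X ^ m * X ^ m) = (A * E - B * C) ^ 2 * (X ^ n * X ^ n) := by
    apply mul_left_cancel₀ h4D
    rw [hg, hcg, hbg] at hdisc
    linear_combination hdisc
  have hdvd : X ^ (m + m) ∣ X ^ (n + n) := by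
    rw [← (hdet.pow 2).dvd_mul_left, pow_add, pow_add, ← hfin]
    exact Dvd.intro_left _ rfl
  have := (pow_dvd_pow_iff Polynomial.X_ne_zero Polynomial.not_isUnit_X).1 hdvd
  omega

theorem eq_of_equivalent [CharZero K] {D : K[X]} (hD : D ≠ 0) {s : SeriesAtInfinity K}
    (hs : s ^ 2 = ofPoly D) (hirr : Irr s) {P Q : K[X]} {n m : ℕ}
    (hP : P.coeff 0 ^ 2 ≠ D.coeff 0) (hQ : Q.coeff 0 ^ 2 ≠ D.coeff 0)
    (h : Equivalent ((s - ofPoly P) / ofPoly (Polynomial.X ^ n))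
      ((s - ofPoly Q) / ofPoly (Polynomial.X ^ m))) : n = m := by
  obtain ⟨A, B, C, E, hdet, hrel⟩ := h.exists_entries
  refine le_antisymm ?_ (le_of_mobius_eq hD hs hirr hQ hdet hrel)
  -- This is the inverse Möbius map, up to sign.
  refine le_of_mobius_eq hD hs hirr hP (A := -E) (B := B) (C := C) (E := -A) (P := Q) ?_ ?_
  · convert hdet using 1; ring
  · simp only [map_neg]
    linear_combination hrel

end Equivalence

/-! ### Square roots over a coefficient field -/

section SquareRoot

/-- Substitute `f - 1` into the binomial series of `(1 + X)^(1/2)`. -/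
theorem exists_sq_eq_of_constantCoeff_one {F : Type*} [Field F] [CharZero F] {f : PowerSeries F}
    (hf : PowerSeries.constantCoeff f = 1) : ∃ h : PowerSeries F, h ^ 2 = f := by
  have hg : PowerSeries.HasSubst (f - 1) :=
    PowerSeries.HasSubst.of_constantCoeff_zero' (by simp [hf])
  have key : PowerSeries.binomialSeries F (1 / 2 : ℚ) * PowerSeries.binomialSeries F (1 / 2 : ℚ) =
      1 + PowerSeries.X := by
    rw [← PowerSeries.binomialSeries_add]
    rw [show (1 / 2 : ℚ) + 1 / 2 = (1 : ℕ) by norm_num, PowerSeries.binomialSeries_nat, pow_one]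
  refine ⟨PowerSeries.subst (f - 1) (PowerSeries.binomialSeries F (1 / 2 : ℚ)), ?_⟩
  rw [pow_two, ← PowerSeries.subst_mul hg, key, ← PowerSeries.coe_substAlgHom hg, map_add, map_one,
    PowerSeries.coe_substAlgHom, PowerSeries.subst_X hg, add_sub_cancel]

theorem coeff_ofPowerSeries (f : PowerSeries K) (n : ℤ) :
    (HahnSeries.ofPowerSeries ℤ K f).coeff n =
      if n < 0 then 0 else PowerSeries.coeff n.natAbs f :=
  PowerSeries.coeff_coe f n

/-- A polynomial over `F` of even degree whose leading coefficient is a square in `F` has a square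
root in `F((T⁻¹))`. -/
theorem exists_sq_eq_ofPoly [CharZero K] {D : K[X]} (hD : D ≠ 0) (heven : Even D.natDegree)
    {F : Subfield K} (hF : ∀ i, D.coeff i ∈ F) {u : K} (hu : u ∈ F)
    (hDu : D.leadingCoeff = u ^ 2) :
    ∃ s : SeriesAtInfinity K, s ^ 2 = ofPoly D ∧ ∀ n, s.coeff n ∈ F := by
  obtain ⟨d, hd⟩ := heven
  have hu0 : u ≠ 0 := by
    rintro rfl
    exact hD (Polynomial.leadingCoeff_eq_zero.1 (by simpa using hDu))
  -- `f` is `D / (u²T²ᵈ)` as a series in `T⁻¹`; the root is `uTᵈ√f`.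
  let f : PowerSeries F := PowerSeries.mk fun j =>
    if j ≤ d + d then ⟨D.coeff (d + d - j) / u ^ 2, F.div_mem (hF _) (F.pow_mem hu 2)⟩ else 0
  have hf : PowerSeries.constantCoeff f = 1 := by
    rw [← PowerSeries.coeff_zero_eq_constantCoeff_apply, PowerSeries.coeff_mk, if_pos (Nat.zero_le _)]
    ext
    change D.coeff (d + d - 0) / u ^ 2 = 1
    rw [tsub_zero, ← hd, Polynomial.coeff_natDegree, hDu]
    exact div_self (pow_ne_zero 2 hu0)
  obtain ⟨h, hh⟩ := exists_sq_eq_of_constantCoeff_one hf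
  have hcoeff : ∀ n, (HahnSeries.single (-(d : ℤ)) u *
      HahnSeries.ofPowerSeries ℤ K (PowerSeries.map F.subtype h)).coeff n ∈ F := by
    intro n
    rw [HahnSeries.coeff_single_mul, coeff_ofPowerSeries]
    split_ifs
    · rw [mul_zero]; exact F.zero_mem
    · rw [PowerSeries.coeff_map]
      exact F.mul_mem hu (SetLike.coe_mem _)
  refine ⟨_, ?_, hcoeff⟩
  rw [mul_pow, HahnSeries.single_pow, ← map_pow (HahnSeries.ofPowerSeries ℤ K),
    ← map_pow (PowerSeries.map F.subtype), hh]
  ext n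
  rw [HahnSeries.coeff_single_mul, coeff_ofPowerSeries]
  have hn : n - 2 • -(d : ℤ) = n + (d + d) := by simp; ring
  rw [hn]
  split_ifs with hneg
  · obtain ⟨i, rfl⟩ : ∃ i : ℕ, n = -(i : ℤ) := ⟨n.natAbs, by omega⟩
    rw [coeff_ofPoly_neg, Polynomial.coeff_eq_zero_of_natDegree_lt (by omega), mul_zero]
  · rw [PowerSeries.coeff_map, PowerSeries.coeff_mk]
    split_ifs with hle
    · obtain ⟨i, rfl⟩ : ∃ i : ℕ, n = -(i : ℤ) := ⟨n.natAbs, by omega⟩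
      rw [coeff_ofPoly_neg, show d + d - (-(i : ℤ) + (d + d)).natAbs = i by omega]
      exact mul_div_cancel₀ _ (pow_ne_zero 2 hu0)
    · rw [map_zero, mul_zero, coeff_ofPoly_of_pos _ (by omega)]

end SquareRoot

/-! ### Iterating `(α - c)/T` -/

section Construction

theorem coeff_sub_div_X_mem {F : Subfield K} {α : SeriesAtInfinity K} (hα : ∀ n, α.coeff n ∈ F)
    {c : K} (hc : c ∈ F) (n : ℤ) :
    ((α - ofPoly (Polynomial.C c)) / ofPoly Polynomial.X).coeff n ∈ F := by
  have hinv : (ofPoly (Polynomial.X : K[X]))⁻¹ = HahnSeries.single (1 : ℤ) (1 : K) := by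
    rw [inv_eq_iff_eq_inv, HahnSeries.inv_single, inv_one, ofPoly_X]
  rw [div_eq_mul_inv, hinv, mul_comm, HahnSeries.coeff_single_mul, one_mul, HahnSeries.coeff_sub,
    ofPoly_C, HahnSeries.coeff_single]
  refine F.sub_mem (hα _) ?_
  split_ifs
  exacts [hc, F.zero_mem]

theorem isIntegral_rat (x : AlgebraicClosure ℚ) : IsIntegral ℚ x := by
  have h := (AlgebraicClosure.isAlgebraic ℚ).isAlgebraic x
  convert h.isIntegral
  · rfl
  · exact Subsingleton.elim _ _

/-- A `p`-th root of 2 has degree `p`, for arbitrarily large primes `p`. -/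
theorem not_finiteDimensional : ¬ FiniteDimensional ℚ (AlgebraicClosure ℚ) := by
  intro h
  obtain ⟨p, hlt, hp⟩ := Nat.exists_infinite_primes (Module.finrank ℚ (AlgebraicClosure ℚ) + 1)
  have hirr : Irreducible (Polynomial.X ^ p - Polynomial.C (2 : ℚ)) := by
    refine X_pow_sub_C_irreducible_of_prime hp fun b hb => ?_
    have hb0 : b ≠ 0 := by rintro rfl; simp [hp.ne_zero] at hb
    have := congrArg (padicValRat 2) hb
    rw [padicValRat.pow] at this
    have h2 : padicValRat 2 (2 : ℚ) = 1 := by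
      exact_mod_cast padicValRat.self (p := 2) (by norm_num)
    rw [h2] at this
    have := Int.isUnit_iff.1 (IsUnit.of_mul_eq_one _ this)
    have := hp.two_le
    omega
  obtain ⟨x, hx⟩ := IsAlgClosed.exists_pow_nat_eq (2 : AlgebraicClosure ℚ) hp.pos
  have hmin := minpoly.eq_of_irreducible_of_monic hirr (x := x) (by simp [hx])
    (Polynomial.monic_X_pow_sub_C _ hp.ne_zero)
  have := minpoly.natDegree_le (A := ℚ) x
  rw [← hmin, Polynomial.natDegree_X_pow_sub_C] at this
  omega

theorem exists_notMem_of_finiteDimensional (F : IntermediateField ℚ (AlgebraicClosure ℚ))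
    [FiniteDimensional ℚ F] : ∃ c, c ∉ F := by
  by_contra! h
  have hF : F = ⊤ := eq_top_iff.2 fun x _ => h x
  subst hF
  exact not_finiteDimensional
    (Module.Finite.equiv (IntermediateField.topEquiv (F := ℚ) (E := AlgebraicClosure ℚ)).toLinearEquiv)

/-- Elements `(√D - P) / T^n` that become less and less approximable as `n` grows. -/
theorem exists_badlyApprox_sub_div_pow {D : (AlgebraicClosure ℚ)[X]} (hD : ¬ IsSquare D)
    {s : SeriesAtInfinity (AlgebraicClosure ℚ)} (hs : s ^ 2 = ofPoly D)
    (F₀ : IntermediateField ℚ (AlgebraicClosure ℚ)) [FiniteDimensional ℚ F₀]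
    (hF₀ : ∀ n, s.coeff n ∈ F₀) {r : AlgebraicClosure ℚ} (hr : r ∈ F₀) (hrD : r ^ 2 = D.coeff 0)
    (n : ℕ) :
    ∃ (P : (AlgebraicClosure ℚ)[X]) (F : IntermediateField ℚ (AlgebraicClosure ℚ)),
      FiniteDimensional ℚ F ∧ r ∈ F ∧
      (∀ k, ((s - ofPoly P) / ofPoly (Polynomial.X ^ n)).coeff k ∈ F) ∧
      BadlyApprox (max 1 (D.natDegree - n)) ((s - ofPoly P) / ofPoly (Polynomial.X ^ n)) ∧
      (n = 0 ∧ P = 0 ∨ n ≠ 0 ∧ P.coeff 0 ^ 2 ≠ D.coeff 0) := by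
  induction n with
  | zero =>
    refine ⟨0, F₀, inferInstance, hr, by simpa using hF₀, ?_, Or.inl ⟨rfl, rfl⟩⟩
    simpa using (badlyApprox_of_sq_eq hD hs).mono (le_max_right 1 _)
  | succ n ih =>
    obtain ⟨P, F, hfin, hrF, hcoeff, hbad, hP⟩ := ih
    obtain ⟨c, hc⟩ := exists_notMem_of_finiteDimensional F
    have hirr := (irr_of_sq_eq hD hs).sub_div_pow P n
    have e : (s - ofPoly (P + Polynomial.C c * Polynomial.X ^ n)) /
          ofPoly (Polynomial.X ^ (n + 1)) =
        ((s - ofPoly P) / ofPoly (Polynomial.X ^ n) - ofPoly (Polynomial.C c)) /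
          ofPoly Polynomial.X := by
      have hX : ofPoly (Polynomial.X : (AlgebraicClosure ℚ)[X]) ≠ 0 :=
        ofPoly_ne_zero Polynomial.X_ne_zero
      simp only [map_add, map_mul, map_pow]
      field_simp
      ring
    have : FiniteDimensional ℚ (IntermediateField.adjoin ℚ {c}) :=
      IntermediateField.adjoin.finiteDimensional (isIntegral_rat c)
    refine ⟨P + Polynomial.C c * Polynomial.X ^ n, F ⊔ IntermediateField.adjoin ℚ {c},
      inferInstance, (le_sup_left : F ≤ _) hrF, ?_, ?_, Or.inr ⟨n.succ_ne_zero, ?_⟩⟩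
    · rw [e]
      exact coeff_sub_div_X_mem (F := (F ⊔ IntermediateField.adjoin ℚ {c}).toSubfield)
        (fun k => (le_sup_left : F ≤ _) (hcoeff k))
        ((le_sup_right : IntermediateField.adjoin ℚ {c} ≤ _)
          (IntermediateField.mem_adjoin_simple_self ℚ c))
    · rw [e]
      exact BadlyApprox.sub_div_X (F := F.toSubfield) hcoeff hirr hc (le_max_left _ _)
        (hbad.mono (by omega))
    -- Only the first step sets the constant term: it is `c ∉ F`, whereas `±r ∈ F`.
    · rcases hP with ⟨rfl, rfl⟩ | ⟨hn, hP⟩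
      · intro h
        simp only [zero_add, pow_zero, mul_one, Polynomial.coeff_C_zero, ← hrD] at h
        rcases sq_eq_sq_iff_eq_or_eq_neg.1 h with rfl | rfl
        exacts [hc hrF, hc (neg_mem hrF)]
      · simpa [Polynomial.coeff_X_pow, hn.symm] using hP

end Construction

end PolyCF

theorem mainTheorem7 (D : (AlgebraicClosure ℚ)[X])
    (hD : D ∈ PolyCF.admissible (AlgebraicClosure ℚ)) :
    ∃ S : Set (PolyCF.SeriesAtInfinity (AlgebraicClosure ℚ)),
      S.Infinite ∧
      (∀ α ∈ S, α ∈ PolyCF.sqrtField D ∧ α ∉ PolyCF.ratField (AlgebraicClosure ℚ) ∧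
        PolyCF.IsNormal α) ∧
      S.Pairwise (fun α β => ¬ PolyCF.Equivalent α β) := by
  obtain ⟨-, heven, hsq, u, hu⟩ := hD
  have hD0 : D ≠ 0 := fun h => hsq (h ▸ IsSquare.zero)
  obtain ⟨r, hr⟩ := IsAlgClosed.exists_pow_nat_eq (D.coeff 0) two_pos
  -- `u` puts `√D` over the number field; `r` keeps the first `c` away from the roots of `D(0)`.
  let G : Set (AlgebraicClosure ℚ) := insert u (insert r (D.coeffs : Set (AlgebraicClosure ℚ)))
  have hG : Finite G := ((D.coeffs.finite_toSet.insert r).insert u).to_subtype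
  have : FiniteDimensional ℚ (IntermediateField.adjoin ℚ G) :=
    IntermediateField.finiteDimensional_adjoin fun x _ => PolyCF.isIntegral_rat x
  have hsub : G ⊆ IntermediateField.adjoin ℚ G := IntermediateField.subset_adjoin ℚ G
  have hcoeff : ∀ i, D.coeff i ∈ IntermediateField.adjoin ℚ G := by
    intro i
    by_cases hi : D.coeff i = 0
    · rw [hi]; exact zero_mem _
    · exact hsub (Or.inr (Or.inr (Polynomial.coeff_mem_coeffs hi)))
  obtain ⟨s, hs, hsF⟩ := PolyCF.exists_sq_eq_ofPoly hD0 heven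
    (F := (IntermediateField.adjoin ℚ G).toSubfield) hcoeff (hsub (Or.inl rfl))
    (hu.trans (pow_two u).symm)
  have hirr := PolyCF.irr_of_sq_eq hsq hs
  choose P F _ _ _ hbad hP using PolyCF.exists_badlyApprox_sub_div_pow hsq hs
    (IntermediateField.adjoin ℚ G) hsF (hsub (Or.inr (Or.inl rfl))) hr
  -- Starting past `deg D` brings the bound down to 1, and a nonzero index gives `P(0)² ≠ D(0)`.
  let α : ℕ → PolyCF.SeriesAtInfinity (AlgebraicClosure ℚ) := fun n =>
    (s - PolyCF.ofPoly (P (n + D.natDegree + 1))) /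
      PolyCF.ofPoly (Polynomial.X ^ (n + D.natDegree + 1))
  have hα : ∀ n m, PolyCF.Equivalent (α n) (α m) → n = m := by
    intro n m h
    have := PolyCF.eq_of_equivalent hD0 hs hirr ((hP _).resolve_left fun h => Nat.succ_ne_zero _ h.1).2
      ((hP _).resolve_left fun h => Nat.succ_ne_zero _ h.1).2 h
    omega
  refine ⟨Set.range α, Set.infinite_range_of_injective fun n m h => hα n m ?_, ?_, ?_⟩
  · rw [h]
    exact PolyCF.Equivalent.refl _
  · rintro _ ⟨n, rfl⟩
    have hi := hirr.sub_div_pow (P (n + D.natDegree + 1)) (n + D.natDegree + 1)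
    refine ⟨?_, hi.notMem_ratField, PolyCF.BadlyApprox.isNormal ?_ hi⟩
    · exact div_mem (sub_mem (Subfield.subset_closure (Or.inr hs))
        (Subfield.subset_closure (Or.inl ⟨_, rfl⟩))) (Subfield.subset_closure (Or.inl ⟨_, rfl⟩))
    · exact (hbad _).mono (by omega)
  · rintro _ ⟨n, rfl⟩ _ ⟨m, rfl⟩ hne h
    exact hne (congrArg α (hα n m h))
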